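/- Let $n>m\ge 1$ be coprime integers. Write $\mathbb{P}^2_{\mathbb{K}}$ for the projective plane over $\mathbb{K}\in\{\mathbb{R},\mathbb{C}\}$ and regard $\mathbb{P}^2_{\mathbb{R}}\subset\mathbb{P}^2_{\mathbb{C}}$ via real homogeneous coordinates. Let $\Omega_n\subset\mathbb{P}^2_{\mathbb{C}}$ be the set of points $[1:b:c]$, $b,c\in\mathbb{C}$, such that the trinomial $\zeta^n+b\zeta^m+c$ is Schur stable, i.e. all its complex roots have modulus strictly less than one; a point of $\mathbb{P}^2_{\mathbb{K}}$ is called Schur stable if it belongs to $\Omega_n$. For $b,c\in\mathbb{C}$ let $$\Pi_n([1:b:c])=[1:|b|:(-1)^n|c|]\in\mathbb{P}^2_{\mathbb{R}}.$$ Then the following hold. (i) Let $x,y\in\mathbb{R}$ with $x\ge 0$ and $(-1)^n y\ge 0$. If $[1:x:y]\notin\Pi_n(\Omega_n)$, then $$[1:x e^{\mathsf{i}t}e^{-\mathsf{i}(n-m)s}:y e^{-\mathsf{i}ns}]\notin\Omega_n\qquad\text{for all } t\in\mathbb{R} \text{ and } s\in[0,2\pi].$$ (ii) Let $b,c\in\mathbb{C}$.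 If $\Pi_n([1:b:c])$ is not Schur stable, i.e. $\Pi_n([1:b:c])\notin\Omega_n$, then $[1:b:c]$ is not Schur stable. -/

import Mathlib

open scoped LinearAlgebra.Projectivization

/-- A complex polynomial is Schur stable if all its complex roots lie in the open unit disc. -/
def IsSchurStable (p : Polynomial ℂ) : Prop :=
  ∀ z : ℂ, p.IsRoot z → ‖z‖ < 1

/-- The trinomial `ζ ^ n + b ζ ^ m + c`. -/
noncomputable def trinomial (n m : ℕ) (b c : ℂ) : Polynomial ℂ :=
  Polynomial.X ^ n + Polynomial.C b * Polynomial.X ^ m + Polynomial.C c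

/-- The projective plane over `K`. -/
abbrev ProjPlane (K : Type) [Field K] : Type := ℙ K (Fin 3 → K)

theorem affineVec_ne_zero {K : Type} [Field K] (b c : K) : (![1, b, c] : Fin 3 → K) ≠ 0 :=
  fun h => one_ne_zero (congrFun h 0)

/-- The point `[1 : b : c]` of the projective plane over `K`. -/
def affinePt {K : Type} [Field K] (b c : K) : ProjPlane K :=
  Projectivization.mk K ![1, b, c] (affineVec_ne_zero b c)

/-- The stability region: the set of points `[1 : b : c]` of the complex projective plane such that
`ζ ^ n + b ζ ^ m + c` is Schur stable. -/
def stabilityRegion (n m : ℕ) : Set (ProjPlane ℂ) :=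
  {p | ∃ b c : ℂ, p = affinePt b c ∧ IsSchurStable (trinomial n m b c)}

/-- The vector of signed moduli `(|a|, |b|, (-1) ^ n |c|)` of `(a, b, c)`. -/
noncomputable def modVec (n : ℕ) (v : Fin 3 → ℂ) : Fin 3 → ℝ :=
  ![‖v 0‖, ‖v 1‖, (-1) ^ n * ‖v 2‖]

theorem modVec_ne_zero (n : ℕ) {v : Fin 3 → ℂ} (hv : v ≠ 0) : modVec n v ≠ 0 := by
  intro h
  apply hv
  have h0 := congrFun h 0
  have h1 := congrFun h 1
  have h2 := congrFun h 2
  simp [modVec] at h0 h1 h2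
  funext i
  fin_cases i <;> simp [h0, h1, h2]

theorem modVec_smul (n : ℕ) (t : ℂ) (v : Fin 3 → ℂ) :
    modVec n (t • v) = ‖t‖ • modVec n v := by
  funext i
  fin_cases i <;> simp [modVec]
  ring

/-- The projection `[a : b : c] ↦ [|a| : |b| : (-1) ^ n |c|]` from the complex to the real projective
plane. On the points `[1 : b : c]` it is `[1 : b : c] ↦ [1 : |b| : (-1) ^ n |c|]`. -/
noncomputable def realProj (n : ℕ) : ProjPlane ℂ → ProjPlane ℝ :=
  Projectivization.lift
    (fun v : {v : Fin 3 → ℂ // v ≠ 0} =>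
      Projectivization.mk ℝ (modVec n v.1) (modVec_ne_zero n v.2))
    (by
      rintro ⟨v, hv⟩ ⟨w, hw⟩ t rfl
      rw [Projectivization.mk_eq_mk_iff']
      exact ⟨‖t‖, (modVec_smul n t w).symm⟩)

theorem realProj_affinePt (n : ℕ) (b c : ℂ) :
    realProj n (affinePt b c) = affinePt ‖b‖ ((-1) ^ n * ‖c‖) := by
  simp [realProj, affinePt, Projectivization.lift_mk, modVec]

/-- Coordinatewise inclusion of `ℝ³` into `ℂ³`. -/
noncomputable def complexifyVec : (Fin 3 → ℝ) →ₛₗ[Complex.ofRealHom] (Fin 3 → ℂ) where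
  toFun v i := (v i : ℂ)
  map_add' v w := by funext i; simp
  map_smul' r v := by funext i; simp

theorem complexifyVec_injective : Function.Injective complexifyVec := fun _ _ h =>
  funext fun i => Complex.ofReal_injective (congrFun h i)

/-- The inclusion `[a : b : c] ↦ [a : b : c]` of the real into the complex projective plane. -/
noncomputable def complexify : ProjPlane ℝ → ProjPlane ℂ :=
  Projectivization.map complexifyVec complexifyVec_injective

open Filter Topology

/-! (i) is immediate: the unimodular factors disappear under `realProj`. For (ii), let `b, c > 0` be
the moduli of the coefficients of a stable trinomial. Rotating `z` normalises the constant term to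
`(-1) ^ n * c`; by coprimality and conjugation only a phase `t ∈ [0, π / n]` of the middle term
remains (`of_invariant`). If `b + c < 1`, every phase is stable. Otherwise `π / n` is unstable, so
if `0` were unstable too, a stable `t` would lie between two transitions, each with a zero on the
unit circle. Such a zero gives a triangle with sides `1, b, c`, which fixes `cos (n * t)`, so only
one transition is possible (`phase_unique`). -/

/-- All complex zeros of `z ^ n + B * z ^ m + C` lie in the open unit disc. -/
def TrinomialStable (n m : ℕ) (B C : ℂ) : Prop :=
  ∀ z : ℂ, z ^ n + B * z ^ m + C = 0 → ‖z‖ < 1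

theorem isSchurStable_trinomial_iff (n m : ℕ) (B C : ℂ) :
    IsSchurStable (trinomial n m B C) ↔ TrinomialStable n m B C := by
  simp [IsSchurStable, trinomial, TrinomialStable, Polynomial.IsRoot]

theorem affinePt_inj {K : Type} [Field K] {b c b' c' : K} (h : affinePt b c = affinePt b' c') :
    b = b' ∧ c = c' := by
  unfold affinePt at h
  rw [Projectivization.mk_eq_mk_iff'] at h
  obtain ⟨a, ha⟩ := h
  have h0 := congrFun ha 0
  have h1 := congrFun ha 1
  have h2 := congrFun ha 2
  simp at h0 h1 h2
  subst h0
  simp at h1 h2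
  exact ⟨h1.symm, h2.symm⟩

theorem affinePt_mem_stabilityRegion_iff (n m : ℕ) (b c : ℂ) :
    affinePt b c ∈ stabilityRegion n m ↔ TrinomialStable n m b c := by
  rw [← isSchurStable_trinomial_iff]
  constructor
  · rintro ⟨b', c', h, hs⟩
    obtain ⟨rfl, rfl⟩ := affinePt_inj h
    exact hs
  · exact fun h => ⟨b, c, rfl, h⟩

theorem complexify_affinePt (x y : ℝ) :
    complexify (affinePt x y) = affinePt (x : ℂ) (y : ℂ) := by
  unfold complexify affinePt
  rw [Projectivization.map_mk]
  congr 1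
  funext i
  fin_cases i <;> simp [complexifyVec]

/-! ### Symmetries of stability -/

theorem TrinomialStable.rotate {n m : ℕ} (hmn : m < n) {B C u : ℂ} (hu : ‖u‖ = 1)
    (h : TrinomialStable n m (B * u ^ (n - m)) (C * u ^ n)) : TrinomialStable n m B C := by
  intro z hz
  have := h (u * z) (by
    have e : u ^ n = u ^ (n - m) * u ^ m := by rw [← pow_add]; congr 1; omega
    rw [mul_pow, mul_pow]
    calc _ = u ^ n * z ^ n + B * (u ^ (n - m) * u ^ m) * z ^ m + C * u ^ n := by ring
      _ = u ^ n * (z ^ n + B * z ^ m + C) := by rw [← e]; ring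
      _ = 0 := by rw [hz, mul_zero])
  simpa [hu] using this

theorem TrinomialStable.conj {n m : ℕ} {B C : ℂ} (h : TrinomialStable n m B C) :
    TrinomialStable n m (starRingEnd ℂ B) (starRingEnd ℂ C) := by
  intro z hz
  have := h (starRingEnd ℂ z) (by
    have := congrArg (starRingEnd ℂ) hz
    simpa using this)
  simpa using this

/-- The modulus of the constant coefficient and `B ^ n / C ^ (n - m)` determine the stability of the
trinomial. -/
theorem TrinomialStable.of_invariant {n m : ℕ} (hmn : m < n) (hcop : Nat.Coprime n m)
    {B C B' C' : ℂ} (hC : C ≠ 0) (hB : B ≠ 0) (hCC : ‖C‖ = ‖C'‖)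
    (hinv : B' ^ n * C ^ (n - m) = B ^ n * C' ^ (n - m))
    (h : TrinomialStable n m B' C') : TrinomialStable n m B C := by
  have hn : 0 < n := by omega
  have hC' : C' ≠ 0 := by rw [← norm_ne_zero_iff, ← hCC]; simpa using hC
  -- `u` matches the constant terms; the middle terms then differ by an `n`-th root of unity `w`. As
  -- `n - m` is prime to `n`, a power of `w` corrects this without changing `u ^ n`.
  obtain ⟨u, hu⟩ := IsAlgClosed.exists_pow_nat_eq (C' / C) hn
  have hu1 : ‖u‖ = 1 := by
    have : ‖u‖ ^ n = 1 := by
      rw [← norm_pow, hu, norm_div, hCC, div_self (by simpa using hC')]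
    exact (pow_eq_one_iff_of_nonneg (norm_nonneg u) hn.ne').1 this
  have hu0 : u ≠ 0 := by rw [← norm_ne_zero_iff, hu1]; exact one_ne_zero
  set w := B' / (B * u ^ (n - m)) with hw
  have hwn : w ^ n = 1 := by
    rw [hw, div_pow, mul_pow, ← pow_mul, mul_comm (n - m) n, pow_mul, hu, div_pow]
    field_simp
    exact hinv
  have hw1 : ‖w‖ = 1 :=
    (pow_eq_one_iff_of_nonneg (norm_nonneg w) hn.ne').1 (by rw [← norm_pow, hwn, norm_one])
  have hcop' : Nat.Coprime (n - m) n :=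
    (Nat.coprime_self_sub_right hmn.le).2 hcop |>.symm
  obtain ⟨j, hj⟩ : ∃ j : ℕ, w ^ (j * (n - m)) = w := by
    obtain ⟨j, hj⟩ := exists_pow_eq_self_of_coprime
      (hcop'.coprime_dvd_right (orderOf_dvd_of_pow_eq_one hwn))
    exact ⟨j, by rw [mul_comm, pow_mul, hj]⟩
  apply TrinomialStable.rotate hmn (u := u * w ^ j) (by simp [hu1, hw1])
  have e1 : B * (u * w ^ j) ^ (n - m) = B' := by
    rw [mul_pow, ← pow_mul, hj, hw]
    field_simp
  have e2 : C * (u * w ^ j) ^ n = C' := by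
    rw [mul_pow, ← pow_mul, mul_comm j n, pow_mul, hwn, one_pow, hu]
    field_simp
  rwa [e1, e2]

/-! ### Root bounds and limits -/

/-- A trinomial with all zeros in the open unit disc is bounded below outside of it. -/
theorem TrinomialStable.le_norm {n m : ℕ} (hmn : m < n) {B C : ℂ} (h : TrinomialStable n m B C)
    {w : ℂ} (hw : 1 ≤ ‖w‖) : (‖w‖ - 1) ^ n ≤ ‖w ^ n + B * w ^ m + C‖ := by
  set p := trinomial n m B C with hp
  have hdeg : (Polynomial.C B * Polynomial.X ^ m + Polynomial.C C).degree < (n : WithBot ℕ) := by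
    refine lt_of_le_of_lt (Polynomial.degree_add_le _ _) (max_lt ?_ ?_)
    · exact lt_of_le_of_lt (Polynomial.degree_C_mul_X_pow_le _ _) (by exact_mod_cast hmn)
    · exact lt_of_le_of_lt Polynomial.degree_C_le (by exact_mod_cast (by omega : 0 < n))
  have hp' : p = Polynomial.X ^ n + (Polynomial.C B * Polynomial.X ^ m + Polynomial.C C) := by
    rw [hp, trinomial, add_assoc]
  have hmonic : p.Monic := hp' ▸ Polynomial.monic_X_pow_add hdeg
  have hnat : p.natDegree = n := by
    rw [hp']
    rw [Polynomial.natDegree_add_eq_left_of_degree_lt (by rwa [Polynomial.degree_X_pow]),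
      Polynomial.natDegree_X_pow]
  have hsplit : p.Splits := IsAlgClosed.splits p
  have hcard : p.roots.card = n := by rw [← hnat]; exact hsplit.natDegree_eq_card_roots.symm
  have heval : p.eval w = (p.roots.map fun r => w - r).prod := by
    rw [hsplit.eval_eq_prod_roots_of_monic hmonic]
  have hev : p.eval w = w ^ n + B * w ^ m + C := by simp [hp, trinomial]
  have hroots : ∀ r ∈ p.roots, ‖r‖ < 1 := fun r hr =>
    (isSchurStable_trinomial_iff n m B C).2 h r (Polynomial.isRoot_of_mem_roots hr)
  rw [← hev, heval, ← hcard]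
  generalize p.roots = s at hroots
  induction s using Multiset.induction_on with
  | empty => simp
  | cons a s ih =>
    rw [Multiset.map_cons, Multiset.prod_cons, Multiset.card_cons, pow_succ', norm_mul]
    have ha := hroots a (Multiset.mem_cons_self a s)
    have h1 : ‖w‖ - 1 ≤ ‖w - a‖ := by linarith [norm_sub_norm_le w a]
    exact mul_le_mul h1 (ih fun r hr => hroots r (Multiset.mem_cons_of_mem hr))
      (by have : 0 ≤ ‖w‖ - 1 := by linarith
          positivity) (norm_nonneg _)

/-- Divide by `‖z‖ ^ (n - 1)`. This confines the zeros that violate stability to a compact annulus.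
-/
theorem norm_le_of_trinomial_eq_zero {n m : ℕ} (hmn : m < n) {B C z : ℂ} (hz : 1 ≤ ‖z‖)
    (h : z ^ n + B * z ^ m + C = 0) : ‖z‖ ≤ ‖B‖ + ‖C‖ := by
  have h1 : ‖z‖ ^ n ≤ ‖B‖ * ‖z‖ ^ m + ‖C‖ := by
    have : z ^ n = -(B * z ^ m + C) := by linear_combination h
    rw [← norm_pow, this, norm_neg, ← norm_pow, ← norm_mul]
    exact norm_add_le _ _
  have h2 : ‖z‖ ^ m ≤ ‖z‖ ^ (n - 1) := pow_le_pow_right₀ hz (by omega)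
  have h3 : 1 ≤ ‖z‖ ^ (n - 1) := one_le_pow₀ hz
  have h4 : ‖z‖ ^ n = ‖z‖ * ‖z‖ ^ (n - 1) := by rw [← pow_succ']; congr 1; omega
  rw [h4] at h1
  refine le_of_mul_le_mul_right ?_ (lt_of_lt_of_le one_pos h3)
  nlinarith [norm_nonneg B, norm_nonneg C, mul_le_mul_of_nonneg_left h2 (norm_nonneg B),
    mul_le_mul_of_nonneg_left h3 (norm_nonneg C)]

theorem TrinomialStable.of_norm_add_lt_one {n m : ℕ} (hmn : m < n) {B C : ℂ}
    (h : ‖B‖ + ‖C‖ < 1) : TrinomialStable n m B C := by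
  intro z hz
  by_contra! h1
  linarith [norm_le_of_trinomial_eq_zero hmn h1 hz]

/-- Stability is an open condition along a path of middle coefficients of constant modulus. -/
theorem isOpen_setOf_trinomialStable {n m : ℕ} (hmn : m < n) {f : ℝ → ℂ} (hf : Continuous f)
    {b : ℝ} (hb : ∀ t, ‖f t‖ = b) (C : ℂ) : IsOpen {t | TrinomialStable n m (f t) C} := by
  rw [isOpen_iff_mem_nhds]
  intro t ht
  set K : Set ℂ := Metric.closedBall 0 (b + ‖C‖) ∩ {z | 1 ≤ ‖z‖} with hK
  have hKc : IsCompact K :=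
    (isCompact_closedBall _ _).inter_right (isClosed_le continuous_const continuous_norm)
  have key : ∀ᶠ s in 𝓝 t, ∀ z ∈ K, z ^ n + f s * z ^ m + C ≠ 0 := by
    apply hKc.eventually_forall_of_forall_eventually
    intro z hz
    have hc : Continuous fun q : ℝ × ℂ => q.2 ^ n + f q.1 * q.2 ^ m + C := by fun_prop
    have : (fun q : ℝ × ℂ => q.2 ^ n + f q.1 * q.2 ^ m + C) (t, z) ≠ 0 := fun h0 =>
      absurd (ht z h0) (not_lt.2 hz.2)
    exact hc.continuousAt.eventually_ne this
  filter_upwards [key] with s hs z hz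
  by_contra! h1
  refine hs z ⟨?_, h1⟩ hz
  rw [mem_closedBall_zero_iff, ← hb s]
  exact norm_le_of_trinomial_eq_zero hmn h1 hz

/-- A limit of stable trinomials has its zeros in the closed unit disc. -/
theorem norm_le_one_of_frequently_trinomialStable {n m : ℕ} (hmn : m < n) {f : ℝ → ℂ}
    (hf : Continuous f) {C : ℂ} {t : ℝ} (h : ∃ᶠ s in 𝓝 t, TrinomialStable n m (f s) C) {w : ℂ}
    (hw : w ^ n + f t * w ^ m + C = 0) : ‖w‖ ≤ 1 := by
  by_contra! h1
  have hc : Continuous fun s => ‖w ^ n + f s * w ^ m + C‖ := by fun_prop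
  have hlim := hc.tendsto t
  rw [hw, norm_zero] at hlim
  -- The lower bound of `le_norm` does not depend on the coefficients, so it survives the limit.
  have hpos : 0 < (‖w‖ - 1) ^ n := pow_pos (by linarith) n
  obtain ⟨s, hs, hs'⟩ := (h.and_eventually (hlim.eventually (gt_mem_nhds hpos))).exists
  exact absurd (hs.le_norm hmn h1.le) (not_le.2 hs')

/-! ### Triangles and zeros on the unit circle -/

/-- A triangle with one side `1` and two further sides of given lengths is unique up to
reflection. -/
theorem eq_or_eq_conj_of_triangle {b c : ℝ} (hb : b ≠ 0) (hc : c ≠ 0) {w v w' v' : ℂ}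
    (hw : ‖w‖ = 1) (hv : ‖v‖ = 1) (hw' : ‖w'‖ = 1) (hv' : ‖v'‖ = 1)
    (h : 1 + b * w + c * v = 0) (h' : 1 + b * w' + c * v' = 0) :
    (w' = w ∧ v' = v) ∨ (w' = starRingEnd ℂ w ∧ v' = starRingEnd ℂ v) := by
  have sq : ∀ {z : ℂ}, ‖z‖ = 1 → z.re ^ 2 + z.im ^ 2 = 1 := by
    intro z hz
    have := Complex.sq_norm z
    rw [hz, Complex.normSq_apply] at this
    linarith
  have hr := congrArg Complex.re h
  have hi := congrArg Complex.im h
  have hr' := congrArg Complex.re h'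
  have hi' := congrArg Complex.im h'
  simp at hr hi hr' hi'
  -- Law of cosines, from `‖b * w‖ = ‖1 + c * v‖`.
  have aux : ∀ {w v : ℂ}, ‖w‖ = 1 → ‖v‖ = 1 → 1 + b * w.re + c * v.re = 0 →
      b * w.im + c * v.im = 0 → 2 * c * v.re = b ^ 2 - 1 - c ^ 2 := by
    intro w v hw hv h1 h2
    have e1 : b * w.re = -1 - c * v.re := by linarith
    have e2 : b * w.im = -(c * v.im) := by linarith
    have : b ^ 2 * (w.re ^ 2 + w.im ^ 2) = 1 + 2 * c * v.re + c ^ 2 * (v.re ^ 2 + v.im ^ 2) := by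
      calc _ = (b * w.re) ^ 2 + (b * w.im) ^ 2 := by ring
        _ = _ := by rw [e1, e2]; ring
    rw [sq hw, sq hv] at this
    linarith
  have hvre : v'.re = v.re := by
    have := (aux hw' hv' hr' hi').trans (aux hw hv hr hi).symm
    exact mul_left_cancel₀ (mul_ne_zero two_ne_zero hc) this
  have hwre : w'.re = w.re := by
    apply mul_left_cancel₀ hb
    rw [hvre] at hr'
    linarith
  have hvim : v'.im = v.im ∨ v'.im = -v.im := by
    apply sq_eq_sq_iff_eq_or_eq_neg.1
    have h1 := sq hv
    have h2 := sq hv'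
    rw [hvre] at h2
    linarith
  rcases hvim with e | e
  · left
    refine ⟨Complex.ext hwre (mul_left_cancel₀ hb ?_), Complex.ext hvre e⟩
    rw [e] at hi'
    linarith
  · right
    refine ⟨Complex.ext (by simpa using hwre) (mul_left_cancel₀ hb ?_),
      Complex.ext (by simpa using hvre) (by simpa using e)⟩
    rw [e] at hi'
    simp
    linarith

/-- The path of middle coefficients of modulus `b`. -/
noncomputable def circlePath (b t : ℝ) : ℂ := b * Complex.exp (t * Complex.I)

theorem continuous_circlePath (b : ℝ) : Continuous (circlePath b) := by
  unfold circlePath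
  fun_prop

theorem norm_circlePath {b : ℝ} (hb : 0 ≤ b) (t : ℝ) : ‖circlePath b t‖ = b := by
  simp [circlePath, Complex.norm_exp_ofReal_mul_I, abs_of_nonneg hb]

theorem circlePath_pow (b t : ℝ) (n : ℕ) :
    circlePath b t ^ n = b ^ n * Complex.exp ((n * t : ℝ) * Complex.I) := by
  rw [circlePath, mul_pow, ← Complex.exp_nat_mul]
  push_cast
  ring_nf

/-- Within a half period there is at most one phase for which a trinomial with coefficients of
given moduli has a zero on the unit circle. -/
theorem phase_unique {n m : ℕ} (hmn : m < n) {b c : ℝ} (hb : b ≠ 0) (hc : c ≠ 0) {s t : ℝ}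
    (hs : s ∈ Set.Icc 0 (Real.pi / n)) (ht : t ∈ Set.Icc 0 (Real.pi / n)) {z y : ℂ}
    (hz : ‖z‖ = 1) (hy : ‖y‖ = 1)
    (h : z ^ n + circlePath b s * z ^ m + (-1) ^ n * c = 0)
    (h' : y ^ n + circlePath b t * y ^ m + (-1) ^ n * c = 0) : s = t := by
  have hn : (0 : ℝ) < n := by exact_mod_cast (by omega : 0 < n)
  have key : ∀ {z : ℂ} {s : ℝ}, ‖z‖ = 1 → z ^ n + circlePath b s * z ^ m + (-1) ^ n * c = 0 →
      ∃ w v : ℂ, ‖w‖ = 1 ∧ ‖v‖ = 1 ∧ 1 + b * w + c * v = 0 ∧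
        Complex.exp ((n * s : ℝ) * Complex.I) = (-1) ^ (n * (n - m)) * (w ^ n / v ^ (n - m)) := by
    intro z s hz h
    have hz0 : z ≠ 0 := by rw [← norm_ne_zero_iff, hz]; exact one_ne_zero
    -- Divide the equation by `z ^ n`; in `w ^ n / v ^ (n - m)` the powers of `z` cancel.
    refine ⟨Complex.exp (s * Complex.I) / z ^ (n - m), (-1) ^ n / z ^ n, ?_, ?_, ?_, ?_⟩
    · simp [hz, Complex.norm_exp_ofReal_mul_I]
    · simp [hz]
    · have e : z ^ n = z ^ (n - m) * z ^ m := by rw [← pow_add]; congr 1; omega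
      have hzn : z ^ n ≠ 0 := pow_ne_zero _ hz0
      apply mul_left_cancel₀ hzn
      rw [mul_zero, ← h, circlePath, mul_add, mul_add, mul_one]
      congr 1
      · congr 1
        nth_rw 1 [e]
        field_simp
      · field_simp
    · have e1 : Complex.exp (s * Complex.I) ^ n = Complex.exp ((n * s : ℝ) * Complex.I) := by
        rw [← Complex.exp_nat_mul]
        push_cast
        ring_nf
      rw [div_pow, e1, div_pow, ← pow_mul, ← pow_mul, ← pow_mul, mul_comm (n - m) n]
      have : ((-1 : ℂ)) ^ (n * (n - m)) ≠ 0 := pow_ne_zero _ (by norm_num)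
      have : z ^ (n * (n - m)) ≠ 0 := pow_ne_zero _ hz0
      field_simp
  obtain ⟨w, v, hw, hv, hwv, e⟩ := key hz h
  obtain ⟨w', v', hw', hv', hwv', e'⟩ := key hy h'
  -- Reflecting the triangle conjugates `exp (i n s)`, which preserves its real part.
  have hcos : Real.cos (n * s) = Real.cos (n * t) := by
    rw [← Complex.exp_ofReal_mul_I_re, ← Complex.exp_ofReal_mul_I_re]
    rcases eq_or_eq_conj_of_triangle hb hc hw hv hw' hv' hwv hwv' with ⟨rfl, rfl⟩ | ⟨rfl, rfl⟩
    · rw [e, e']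
    · have : Complex.exp ((n * t : ℝ) * Complex.I) =
          starRingEnd ℂ (Complex.exp ((n * s : ℝ) * Complex.I)) := by
        rw [e, e']
        simp
      rw [this, Complex.conj_re]
  have mem : ∀ {r : ℝ}, r ∈ Set.Icc 0 (Real.pi / n) → n * r ∈ Set.Icc 0 Real.pi := by
    intro r hr
    refine ⟨mul_nonneg hn.le hr.1, ?_⟩
    have := mul_le_mul_of_nonneg_left hr.2 hn.le
    rwa [mul_div_cancel₀ _ hn.ne'] at this
  exact mul_left_cancel₀ hn.ne' (Real.injOn_cos (mem hs) (mem ht) hcos)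

/-! ### The two ends of the phase interval -/

/-- `r ^ n - b * r ^ m - c` changes sign on `[1, b + c]`. -/
theorem not_trinomialStable_neg {n m : ℕ} (hmn : m < n) {b c : ℝ} (hb : 0 ≤ b) (hc : 0 ≤ c)
    (hbc : 1 ≤ b + c) : ¬ TrinomialStable n m (-b) (-c) := by
  intro h
  set g : ℝ → ℝ := fun r => r ^ n - b * r ^ m - c with hg
  have hcont : ContinuousOn g (Set.Icc 1 (b + c)) := by fun_prop
  have h1 : g 1 ≤ 0 := by simp [hg]; linarith
  have h2 : 0 ≤ g (b + c) := by
    have e2 : (b + c) ^ m ≤ (b + c) ^ (n - 1) := pow_le_pow_right₀ hbc (by omega)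
    have e3 : 1 ≤ (b + c) ^ (n - 1) := one_le_pow₀ hbc
    have e4 : (b + c) ^ n = (b + c) * (b + c) ^ (n - 1) := by rw [← pow_succ']; congr 1; omega
    simp only [hg]
    rw [e4]
    nlinarith [mul_le_mul_of_nonneg_left e2 hb, mul_le_mul_of_nonneg_left e3 hc]
  obtain ⟨r, hr, hr0⟩ := intermediate_value_Icc hbc hcont ⟨h1, h2⟩
  have := h (r : ℂ) (by
    have : (g r : ℂ) = 0 := by rw [hr0]; simp
    simp only [hg] at this
    push_cast at this
    linear_combination this)
  rw [Complex.norm_real, Real.norm_of_nonneg (by linarith [hr.1])] at this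
  linarith [hr.1]

/-- `n` and `m` are not both even. This sign identifies phase `π / n` with the coefficients `-b,
-c`. -/
theorem neg_one_pow_coprime {n m : ℕ} (hmn : m < n) (hcop : Nat.Coprime n m) :
    ((-1 : ℂ) ^ n) ^ (n - m) = -(-1) ^ m := by
  rcases Nat.even_or_odd n with hn | hn
  · have hm : Odd m := by
      rw [← Nat.not_even_iff_odd]
      intro hm
      have := Nat.dvd_gcd hn.two_dvd hm.two_dvd
      rw [hcop] at this
      omega
    rw [hn.neg_one_pow, one_pow, hm.neg_one_pow, neg_neg]
  · rw [hn.neg_one_pow]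
    rcases Nat.even_or_odd m with hm | hm
    · rw [hm.neg_one_pow, (Nat.Odd.sub_even hmn.le hn hm).neg_one_pow]
    · rw [hm.neg_one_pow, (Nat.Odd.sub_odd hn hm).neg_one_pow, neg_neg]

theorem not_trinomialStable_circlePath_pi_div {n m : ℕ} (hmn : m < n) (hcop : Nat.Coprime n m)
    {b c : ℝ} (hb : 0 < b) (hc : 0 < c) (hbc : 1 ≤ b + c) :
    ¬ TrinomialStable n m (circlePath b (Real.pi / n)) ((-1) ^ n * c) := by
  intro h
  refine not_trinomialStable_neg hmn hb.le hc.le hbc (h.of_invariant hmn hcop ?_ ?_ ?_ ?_)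
  · simpa using hc.ne'
  · simpa using hb.ne'
  · simp
  · have hn : (n : ℝ) ≠ 0 := by exact_mod_cast (by omega : n ≠ 0)
    have e : (-1 : ℂ) ^ n = (-1) ^ m * (-1) ^ (n - m) := by
      rw [← pow_add]; congr 1; omega
    rw [circlePath_pow, mul_div_cancel₀ _ hn, Complex.exp_pi_mul_I, mul_pow,
      neg_one_pow_coprime hmn hcop, neg_pow (c : ℂ), neg_pow (b : ℂ), e]
    have e2 : ((-1 : ℂ) ^ m) * (-1) ^ m = 1 := by rw [← mul_pow]; simp
    linear_combination (b : ℂ) ^ n * (-1) ^ (n - m) * c ^ (n - m) * e2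

/-- If some phase is stable, then so is the phase `0`. -/
theorem trinomialStable_circlePath_zero {n m : ℕ} (hmn : m < n) (hcop : Nat.Coprime n m)
    {b c : ℝ} (hb : 0 < b) (hc : 0 < c) {t : ℝ} (ht : t ∈ Set.Icc 0 (Real.pi / n))
    (h : TrinomialStable n m (circlePath b t) ((-1) ^ n * c)) :
    TrinomialStable n m (circlePath b 0) ((-1) ^ n * c) := by
  rcases lt_or_ge (b + c) 1 with hbc | hbc
  · refine TrinomialStable.of_norm_add_lt_one hmn ?_
    rw [norm_circlePath hb.le]
    simpa [abs_of_pos hc] using hbc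
  by_contra h0
  have hpi := not_trinomialStable_circlePath_pi_div hmn hcop hb hc hbc
  set U : Set ℝ := {s | TrinomialStable n m (circlePath b s) ((-1) ^ n * c)}ᶜ with hU
  have hUc : IsClosed U := (isOpen_setOf_trinomialStable hmn (continuous_circlePath b)
    (norm_circlePath hb.le) _).isClosed_compl
  have crit : ∀ {s : ℝ}, s ∈ U → (∃ᶠ r in 𝓝 s, r ∉ U) →
      ∃ z : ℂ, ‖z‖ = 1 ∧ z ^ n + circlePath b s * z ^ m + (-1) ^ n * c = 0 := by
    intro s hs hf
    simp only [hU, Set.mem_compl_iff, Set.mem_ofPred_eq, TrinomialStable, not_forall, not_lt] at hs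
    obtain ⟨z, hz, hz1⟩ := hs
    refine ⟨z, le_antisymm ?_ hz1, hz⟩
    refine norm_le_one_of_frequently_trinomialStable hmn (continuous_circlePath b) ?_ hz
    simpa [hU] using hf
  have htU : t ∉ U := by simpa [hU] using h
  have hK1 : IsCompact (Set.Icc 0 t ∩ U) := isCompact_Icc.inter_right hUc
  have hK2 : IsCompact (Set.Icc t (Real.pi / n) ∩ U) := isCompact_Icc.inter_right hUc
  -- The nearest unstable phases on either side of `t` are limits of stable ones.
  obtain ⟨s₁, ⟨hs₁, hs₁U⟩, hmax⟩ := hK1.exists_isGreatest ⟨0, ⟨le_rfl, ht.1⟩, h0⟩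
  obtain ⟨s₂, ⟨hs₂, hs₂U⟩, hmin⟩ := hK2.exists_isLeast ⟨_, ⟨ht.2, le_rfl⟩, hpi⟩
  have h1 : s₁ < t := lt_of_le_of_ne hs₁.2 (by rintro rfl; exact htU hs₁U)
  have h2 : t < s₂ := lt_of_le_of_ne hs₂.1 (by rintro rfl; exact htU hs₂U)
  obtain ⟨z, hz, hz0⟩ := crit hs₁U (by
    refine Frequently.filter_mono (Eventually.frequently ?_) (nhdsWithin_le_nhds (s := Set.Ioi s₁))
    filter_upwards [Ioc_mem_nhdsGT h1] with r hr hrU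
    exact absurd (hmax ⟨⟨hs₁.1.trans hr.1.le, hr.2⟩, hrU⟩) (not_le.2 hr.1))
  obtain ⟨y, hy, hy0⟩ := crit hs₂U (by
    refine Frequently.filter_mono (Eventually.frequently ?_) (nhdsWithin_le_nhds (s := Set.Iio s₂))
    filter_upwards [Ico_mem_nhdsLT h2] with r hr hrU
    exact absurd (hmin ⟨⟨hr.1, hr.2.le.trans hs₂.2⟩, hrU⟩) (not_le.2 hr.2))
  have := phase_unique hmn hb.ne' hc.ne' ⟨hs₁.1, hs₁.2.trans ht.2⟩ ⟨ht.1.trans hs₂.1, hs₂.2⟩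
    hz hy hz0 hy0
  linarith

/-! ### Reduction to signed moduli -/

theorem TrinomialStable.norm_add_lt_one_of_eq_zero {n m : ℕ} (hmn : m < n) {B C : ℂ}
    (h : TrinomialStable n m B C) (hBC : B = 0 ∨ C = 0) : ‖B‖ + ‖C‖ < 1 := by
  rcases hBC with rfl | rfl
  · obtain ⟨z, hz⟩ := IsAlgClosed.exists_pow_nat_eq (-C) (by omega : 0 < n)
    have hz1 := h z (by rw [hz]; ring)
    have : ‖C‖ = ‖z‖ ^ n := by rw [← norm_pow, hz, norm_neg]
    rw [norm_zero, zero_add, this]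
    exact pow_lt_one₀ (norm_nonneg z) hz1 (by omega)
  · obtain ⟨z, hz⟩ := IsAlgClosed.exists_pow_nat_eq (-B) (by omega : 0 < n - m)
    have e : z ^ n = z ^ (n - m) * z ^ m := by rw [← pow_add]; congr 1; omega
    have hz1 := h z (by rw [e, hz]; ring)
    have : ‖B‖ = ‖z‖ ^ (n - m) := by rw [← norm_pow, hz, norm_neg]
    rw [norm_zero, add_zero, this]
    exact pow_lt_one₀ (norm_nonneg z) hz1 (by omega)

theorem TrinomialStable.signed_moduli {n m : ℕ} (hmn : m < n) (hcop : Nat.Coprime n m) {B C : ℂ}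
    (h : TrinomialStable n m B C) :
    TrinomialStable n m (‖B‖ : ℝ) ((-1) ^ n * (‖C‖ : ℝ)) := by
  by_cases hBC : B = 0 ∨ C = 0
  · exact .of_norm_add_lt_one hmn (by simpa using h.norm_add_lt_one_of_eq_zero hmn hBC)
  push Not at hBC
  obtain ⟨hB, hC⟩ := hBC
  have hb := norm_pos_iff.2 hB
  have hc := norm_pos_iff.2 hC
  have hn : (0 : ℝ) < n := by exact_mod_cast (by omega : 0 < n)
  have hbC : ((‖B‖ : ℝ) : ℂ) ≠ 0 := by exact_mod_cast hb.ne'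
  have hcC : ((‖C‖ : ℝ) : ℂ) ≠ 0 := by exact_mod_cast hc.ne'
  have main : ∀ {B' C' : ℂ}, ‖B'‖ = ‖B‖ → ‖C'‖ = ‖C‖ → TrinomialStable n m B' C' →
      0 ≤ (B' ^ n / C' ^ (n - m) * ((-1) ^ n) ^ (n - m)).arg →
      TrinomialStable n m (‖B‖ : ℝ) ((-1) ^ n * (‖C‖ : ℝ)) := by
    intro B' C' hB' hC' h harg
    -- For `B' = circlePath b t` and `C' = (-1) ^ n * c` this has phase `n * t`, hence the choice `t
    -- = q.arg / n`.
    set q := B' ^ n / C' ^ (n - m) * ((-1) ^ n) ^ (n - m) with hq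
    have hC0 : C' ≠ 0 := by rw [← norm_ne_zero_iff, hC']; exact hc.ne'
    have hqn : ‖q‖ = ‖B‖ ^ n / ‖C‖ ^ (n - m) := by simp [hq, hB', hC']
    have hqe := Complex.norm_mul_exp_arg_mul_I q
    have h0 := trinomialStable_circlePath_zero hmn hcop hb hc (t := q.arg / n)
      ⟨by positivity, by gcongr; exact Complex.arg_le_pi q⟩
      (h.of_invariant hmn hcop ?_ ?_ ?_ ?_)
    · simpa [circlePath] using h0
    · exact mul_ne_zero (pow_ne_zero _ (by norm_num)) hcC
    · rw [← norm_ne_zero_iff, norm_circlePath hb.le]; exact hb.ne'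
    · simp [hC']
    · rw [circlePath_pow, mul_div_cancel₀ _ hn.ne', mul_pow]
      have e : Complex.exp (q.arg * Complex.I) = q * ‖C‖ ^ (n - m) / ‖B‖ ^ n := by
        rw [eq_div_iff (pow_ne_zero _ hbC)]
        nth_rw 2 [← hqe]
        rw [hqn]
        push_cast
        field_simp
      rw [e, hq]
      field_simp
  rcases le_total 0 (B ^ n / C ^ (n - m) * ((-1) ^ n) ^ (n - m)).arg with h1 | h1
  · exact main rfl rfl h h1
  -- Conjugation negates `arg` except at the value `π`.
  · by_cases hpi : (B ^ n / C ^ (n - m) * ((-1) ^ n) ^ (n - m)).arg = Real.pi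
    · exact main rfl rfl h (hpi ▸ Real.pi_pos.le)
    · refine main (Complex.norm_conj B) (Complex.norm_conj C) h.conj ?_
      have e : (starRingEnd ℂ B) ^ n / (starRingEnd ℂ C) ^ (n - m) * ((-1) ^ n) ^ (n - m) =
          starRingEnd ℂ (B ^ n / C ^ (n - m) * ((-1) ^ n) ^ (n - m)) := by simp
      rw [e, Complex.arg_conj, if_neg hpi]
      linarith

theorem corollary1p6 (n m : ℕ) (hm : 0 < m) (hmn : m < n) (hcop : Nat.Coprime n m) :
    (∀ x y : ℝ, 0 ≤ x → 0 ≤ (-1) ^ n * y →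
      affinePt x y ∉ realProj n '' stabilityRegion n m →
      ∀ t : ℝ, ∀ s ∈ Set.Icc (0 : ℝ) (2 * Real.pi),
        affinePt
          ((x : ℂ) * Complex.exp (Complex.I * t) *
            Complex.exp (-(Complex.I * ((n : ℂ) - (m : ℂ)) * s)))
          ((y : ℂ) * Complex.exp (-(Complex.I * (n : ℂ) * s))) ∉ stabilityRegion n m) ∧
    (∀ b c : ℂ,
      complexify (realProj n (affinePt b c)) ∉ stabilityRegion n m →
      affinePt b c ∉ stabilityRegion n m) := by
  refine ⟨?_, ?_⟩
  · intro x y hx hy hnot t s _ hmem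
    refine hnot ⟨_, hmem, ?_⟩
    have e1 : ‖Complex.exp (Complex.I * t)‖ = 1 := by
      rw [mul_comm]
      exact Complex.norm_exp_ofReal_mul_I t
    have e2 : ‖Complex.exp (-(Complex.I * ((n : ℂ) - (m : ℂ)) * s))‖ = 1 := by
      simp [Complex.norm_exp]
    have e3 : ‖Complex.exp (-(Complex.I * (n : ℂ) * s))‖ = 1 := by
      simp [Complex.norm_exp]
    have e4 : (-1 : ℝ) ^ n * |y| = y := by
      have : |y| = (-1) ^ n * y := by
        rw [← abs_of_nonneg hy, abs_mul, abs_pow, abs_neg, abs_one, one_pow, one_mul]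
      rw [this, ← mul_assoc, ← mul_pow]
      simp
    rw [realProj_affinePt, norm_mul, norm_mul, norm_mul, e1, e2, e3, Complex.norm_real,
      Complex.norm_real, Real.norm_of_nonneg hx, Real.norm_eq_abs, mul_one, mul_one, mul_one, e4]
  · intro b c hnot hmem
    apply hnot
    rw [affinePt_mem_stabilityRegion_iff] at hmem
    rw [realProj_affinePt, complexify_affinePt, affinePt_mem_stabilityRegion_iff]
    simpa using hmem.signed_moduli hmn hcop
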